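/- Let $P_k$ denote the path on $k$ vertices. For a graph $F$ and a positive integer $n$, let $\mathrm{ex}^*_{\mathcal P}(n,F)$ (the rainbow planar Turán number of $F$) be the maximum number of edges of an $n$-vertex simple planar graph $G$ that has a proper edge-colouring (any two distinct edges sharing a vertex receive different colours) under which no subgraph of $G$ isomorphic to $F$ is rainbow, i.e. has all its edges of pairwise distinct colours. Then for all integers $n \ge k \ge 8$, \[ \mathrm{ex}^*_{\mathcal P}(n,P_k) = 3n-6 . \] -/

import Mathlib

namespace RainbowPlanar

/-- A drawing of the simple graph `G` in the plane without crossings: vertices are distinct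
points, every edge is a simple (continuous, injective) arc joining its two endpoints, and the
interior of an edge contains neither a vertex nor a point of another edge. The plane is `ℝ × ℝ`;
only its topology plays a role. -/
structure PlaneDrawing {V : Type*} (G : SimpleGraph V) where
  /-- the position of a vertex -/
  point : V → ℝ × ℝ
  /-- a parametrization of the arc that represents an edge -/
  arc : G.edgeSet → unitInterval → ℝ × ℝ
  point_injective : Function.Injective point
  arc_continuous : ∀ e, Continuous (arc e)
  arc_injective : ∀ e, Function.Injective (arc e)
  arc_ends : ∀ e : G.edgeSet, s(arc e 0, arc e 1) = Sym2.map point (e : Sym2 V)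
  arc_ne_point : ∀ e, ∀ t ∈ Set.Ioo (0 : unitInterval) 1, ∀ v, arc e t ≠ point v
  arc_ne_arc : ∀ e f, e ≠ f → ∀ s ∈ Set.Ioo (0 : unitInterval) 1, ∀ t, arc e s ≠ arc f t

/-- A graph is planar if it can be drawn in the plane without crossings. -/
def IsPlanar {V : Type*} (G : SimpleGraph V) : Prop :=
  Nonempty (PlaneDrawing G)

/-- The proper edge-colouring `c` of `G` (a proper vertex colouring of the line graph) is
rainbow-`F`-free: no copy of `F` in `G`, as a not necessarily induced subgraph, has pairwise
distinct colours on its edges. -/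
def RainbowFree {V W K : Type*} (F : SimpleGraph W) {G : SimpleGraph V}
    (c : G.lineGraph.Coloring K) : Prop :=
  ∀ f : SimpleGraph.Copy F G,
    ¬ Function.Injective (fun e : F.edgeSet => c (f.toHom.mapEdgeSet e))

/-- `m` is the rainbow planar Turán number of `F` for `n` vertices: the maximum number of edges
of an `n`-vertex planar graph that has a rainbow-`F`-free proper edge-colouring. Colours are
natural numbers, which is no restriction since the graphs are finite. -/
def IsRainbowPlanarTuranNumber {W : Type*} (n : ℕ) (F : SimpleGraph W) (m : ℕ) : Prop :=
  IsGreatest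
    {m : ℕ | ∃ (G : SimpleGraph (Fin n)) (c : G.lineGraph.Coloring ℕ),
      IsPlanar G ∧ RainbowFree F c ∧ G.edgeSet.ncard = m} m

end RainbowPlanar

/-! The upper bound is the bound 3n - 6 for planar graphs; the colouring plays no role in it.
Euler's formula and the Jordan curve theorem are avoided by weakening planarity: in `WeaklyPlanar`
only vertex-disjoint edges must not meet. This property passes to contractions and excludes K₅ by a
parity count of winding numbers (`no_weak_drawing_K5`). In a counterexample with one edge too many,
some vertex has degree at most 5. Induction on deletions forces its degree to be at least 4, and
induction on contractions gives each edge at it at least 3 common neighbours. Such a neighbourhood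
yields K₅, after at most one contraction.

For the lower bound, join an edge 01 to a path, colour the path with two alternating colours and
give every other edge its own colour. A rainbow path has at most 4 edges at 0 or 1 and at most 2
other edges, so it has fewer than 7 edges. -/

namespace RainbowPlanar

/-! ### Winding numbers and K₅ -/

open Complex

/-- A nowhere vanishing continuous function on the unit square has a continuous logarithm. -/
theorem exists_continuous_log_square (f : unitInterval × unitInterval → ℂ) (hf : Continuous f)
    (h0 : ∀ x, f x ≠ 0) :
    ∃ L : unitInterval × unitInterval → ℂ, Continuous L ∧ ∀ x, exp (L x) = f x := by
  -- Clamping extends `f` to the whole plane, where maps lift through the covering `exp`.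
  let r : ℝ × ℝ → unitInterval × unitInterval :=
    Prod.map (Set.projIcc 0 1 zero_le_one) (Set.projIcc 0 1 zero_le_one)
  have hr : Continuous r := continuous_projIcc.prodMap continuous_projIcc
  obtain ⟨F, ⟨-, hF⟩, -⟩ := isCoveringMapOn_exp.existsUnique_continuousMap_lifts
    ⟨f ∘ r, hf.comp hr⟩ (a₀ := 0) (e₀ := log (f (r 0))) (by simp [exp_log, h0])
    (by intro x; simpa using h0 (r x))
  refine ⟨fun x => F (x.1, x.2), by fun_prop, fun x => ?_⟩
  have := congr_fun hF (x.1, x.2)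
  simpa [r] using this

/-- A nowhere vanishing continuous function on the unit interval has a continuous logarithm. -/
theorem exists_continuous_log (f : unitInterval → ℂ) (hf : Continuous f) (h0 : ∀ x, f x ≠ 0) :
    ∃ L : unitInterval → ℂ, Continuous L ∧ ∀ x, exp (L x) = f x := by
  obtain ⟨L, hL, h⟩ := exists_continuous_log_square (fun x => f x.1) (by fun_prop) fun x => h0 x.1
  exact ⟨fun s => L (s, 0), by fun_prop, fun s => h (s, 0)⟩

/-- The increment of a continuous logarithm along a path does not depend on the logarithm. -/
theorem log_increment_unique {L M : unitInterval → ℂ} (hL : Continuous L) (hM : Continuous M)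
    {z : ℂ} (h : ∀ t, exp (L t) = exp (M t + z)) : L 1 - L 0 = M 1 - M 0 := by
  have hz : exp (M 0 + z) = exp (M 0 + (L 0 - M 0)) := by rw [← h 0]; congr 1; ring
  have hz' : exp z = exp (L 0 - M 0) := by
    rw [exp_add, exp_add] at hz
    exact mul_left_cancel₀ (exp_ne_zero _) hz
  have key : L = fun t => M t + (L 0 - M 0) := by
    refine isCoveringMap_exp.eq_of_comp_eq hL (by fun_prop) ?_ 0 (by ring)
    funext t
    ext
    change exp (L t) = exp (M t + (L 0 - M 0))
    rw [h t, exp_add, exp_add, hz']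
  have h1 := congr_fun key 1
  linear_combination h1

/-- The integers that record how the arguments of the differences of five points change along
the edges of a drawing of the complete graph cannot satisfy these relations. -/
theorem no_winding_numbers (σ : Fin 5 → Fin 5 → ℤ) (hσ : ∀ u v, σ u v = if u < v then 1 else -1)
    (n : Fin 5 → Fin 5 → Fin 5 → ℤ)
    (h : ∀ a b c d, a < b → c < d → a ≠ c → a ≠ d → b ≠ c → b ≠ d →
      2 * (n c a b + n b c d - n a c d - n d a b)
        + (σ b d + σ a c - σ b c - σ a d) = 0) : False := by
  have h' : ∀ a b c d : Fin 5, (a < b ∧ c < d ∧ a ≠ c ∧ a ≠ d ∧ b ≠ c ∧ b ≠ d) →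
      2 * (n c a b + n b c d - n a c d - n d a b) + ((if b < d then 1 else -1) +
        (if a < c then 1 else -1) - (if b < c then 1 else -1) - (if a < d then 1 else -1)) = 0 := by
    intro a b c d ⟨h1, h2, h3, h4, h5, h6⟩
    have := h a b c d h1 h2 h3 h4 h5 h6
    simpa only [hσ] using this
  -- These are the 15 pairs of disjoint edges. Halve each relation and add: every `n v a b` occurs
  -- in exactly two of them, so these terms give an even sum, while the sign terms give 1 for each
  -- of the 5 interleaved pairs a < c < b < d and 0 otherwise. The total is odd, hence not zero.
  have e1 := h' 0 1 2 3 (by decide)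
  have e2 := h' 0 2 1 3 (by decide)
  have e3 := h' 0 3 1 2 (by decide)
  have e4 := h' 0 1 2 4 (by decide)
  have e5 := h' 0 2 1 4 (by decide)
  have e6 := h' 0 4 1 2 (by decide)
  have e7 := h' 0 1 3 4 (by decide)
  have e8 := h' 0 3 1 4 (by decide)
  have e9 := h' 0 4 1 3 (by decide)
  have e10 := h' 0 2 3 4 (by decide)
  have e11 := h' 0 3 2 4 (by decide)
  have e12 := h' 0 4 2 3 (by decide)
  have e13 := h' 1 2 3 4 (by decide)
  have e14 := h' 1 3 2 4 (by decide)
  have e15 := h' 1 4 2 3 (by decide)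
  simp only [Fin.reduceLT, if_true, if_false] at *
  clear h h' hσ
  omega

/-- The complete graph on five vertices cannot be mapped continuously to the plane such that the
images of vertex-disjoint edges are disjoint. -/
theorem no_weak_drawing_K5 (p : Fin 5 → ℂ) (γ : ∀ a b, Path (p a) (p b))
    (hγ : ∀ a b c d, a < b → c < d → a ≠ c → a ≠ d → b ≠ c → b ≠ d →
      ∀ s t, γ a b s ≠ γ c d t) : False := by
  have hpγ : ∀ a b v, a < b → v ≠ a → v ≠ b → ∀ s, γ a b s - p v ≠ 0 := by
    intro a b v hab hva hvb s
    obtain ⟨w, hwa, hwb, hwv⟩ : ∃ w, w ≠ a ∧ w ≠ b ∧ w ≠ v := by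
      clear hγ; revert a b v; decide
    rw [sub_ne_zero]
    rcases lt_or_gt_of_ne hwv with h | h
    · simpa using hγ a b w v hab h hwa.symm hva.symm hwb.symm hvb.symm s 1
    · simpa using hγ a b v w hab h hva.symm hwa.symm hvb.symm hwb.symm s 0
  have hp : ∀ u v, u ≠ v → p u - p v ≠ 0 := by
    intro u v huv
    obtain ⟨w, hwu, hwv⟩ : ∃ w, w ≠ u ∧ w ≠ v := by
      clear hγ hpγ; revert u v; decide
    rcases lt_or_gt_of_ne hwu with h | h
    · simpa using hpγ w u v h hwv.symm huv.symm 1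
    · simpa using hpγ u w v h huv.symm hwv.symm 0
  have hlog : ∀ v a b, ∃ M : unitInterval → ℂ, a < b → v ≠ a → v ≠ b →
      Continuous M ∧ ∀ s, exp (M s) = γ a b s - p v := by
    intro v a b
    by_cases h : a < b ∧ v ≠ a ∧ v ≠ b
    · obtain ⟨M, hM⟩ := exists_continuous_log (fun s => γ a b s - p v) (by fun_prop)
        (hpγ a b v h.1 h.2.1 h.2.2)
      exact ⟨M, fun _ _ _ => hM⟩
    · exact ⟨0, fun h1 h2 h3 => (h ⟨h1, h2, h3⟩).elim⟩
  choose M hM using hlog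
  -- The difference of two disjoint edges has a logarithm on the square, whose increments around the
  -- boundary cancel.
  have hsq : ∀ a b c d, a < b → c < d → a ≠ c → a ≠ d → b ≠ c → b ≠ d →
      (M c a b 1 - M c a b 0) + (M b c d 1 - M b c d 0) =
      (M a c d 1 - M a c d 0) + (M d a b 1 - M d a b 0) := by
    intro a b c d hab hcd hac had hbc hbd
    obtain ⟨L, hL, hLexp⟩ := exists_continuous_log_square
      (fun x => γ a b x.1 - γ c d x.2) (by fun_prop)
      (fun x => sub_ne_zero.2 (hγ a b c d hab hcd hac had hbc hbd x.1 x.2))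
    have hc := hM c a b hab hac.symm hbc.symm
    have hd := hM d a b hab had.symm hbd.symm
    have ha := hM a c d hcd hac had
    have hb := hM b c d hcd hbc hbd
    have e1 := log_increment_unique (L := fun s => L (s, 0)) (by fun_prop) hc.1 (z := 0)
      (fun s => by simp [hLexp, hc.2])
    have e2 := log_increment_unique (L := fun s => L (s, 1)) (by fun_prop) hd.1 (z := 0)
      (fun s => by simp [hLexp, hd.2])
    -- On this side the difference is `p a - γ c d`, the negative of what `M` describes; hence the
    -- shift by πi.
    have e3 := log_increment_unique (L := fun s => L (0, s)) (by fun_prop) ha.1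
      (z := Real.pi * I) (fun s => by simp [hLexp, exp_add, ha.2])
    have e4 := log_increment_unique (L := fun s => L (1, s)) (by fun_prop) hb.1
      (z := Real.pi * I) (fun s => by simp [hLexp, exp_add, hb.2])
    rw [← e1, ← e2, ← e3, ← e4]
    ring
  let σ : Fin 5 → Fin 5 → ℤ := fun u v => if u < v then 1 else -1
  -- Reference logarithms of `p u - p v`, chosen so that swapping the arguments changes them by
  -- exactly ±πi.
  let φ : Fin 5 → Fin 5 → ℂ := fun u v =>
    if u < v then log (p u - p v) else log (p v - p u) + Real.pi * I
  have hφ : ∀ u v, u ≠ v → exp (φ u v) = p u - p v := by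
    intro u v huv
    simp only [φ]
    split_ifs
    · exact exp_log (hp u v huv)
    · rw [exp_add, exp_log (hp v u huv.symm)]; simp
  have hφσ : ∀ u v, u ≠ v → φ v u - φ u v = σ u v * (Real.pi * I) := by
    intro u v huv
    rcases lt_or_gt_of_ne huv with h | h
    · simp [φ, σ, h, h.not_gt]
    · simp [φ, σ, h, h.not_gt]
  have hn : ∀ v a b, ∃ n : ℤ, a < b → v ≠ a → v ≠ b →
      M v a b 1 - M v a b 0 = φ b v - φ a v + n * (2 * Real.pi * I) := by
    intro v a b
    by_cases h : a < b ∧ v ≠ a ∧ v ≠ b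
    · obtain ⟨-, hexp⟩ := hM v a b h.1 h.2.1 h.2.2
      have : exp (M v a b 1 - M v a b 0) = exp (φ b v - φ a v) := by
        rw [exp_sub, exp_sub, hexp, hexp, hφ b v h.2.2.symm, hφ a v h.2.1.symm]
        simp
      obtain ⟨n, hn⟩ := exp_eq_exp_iff_exists_int.1 this
      exact ⟨n, fun _ _ _ => hn⟩
    · exact ⟨0, fun h1 h2 h3 => (h ⟨h1, h2, h3⟩).elim⟩
  choose n hn using hn
  refine no_winding_numbers σ (fun _ _ => rfl) n ?_
  intro a b c d hab hcd hac had hbc hbd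
  have e := hsq a b c d hab hcd hac had hbc hbd
  rw [hn c a b hab hac.symm hbc.symm, hn d a b hab had.symm hbd.symm,
    hn a c d hcd hac had, hn b c d hcd hbc hbd] at e
  have hpi : (Real.pi * I : ℂ) ≠ 0 := by simp [Real.pi_ne_zero]
  have : ((2 * (n c a b + n b c d - n a c d - n d a b)
        + (σ b d + σ a c - σ b c - σ a d) : ℤ) : ℂ) * (Real.pi * I) = 0 := by
    push_cast
    linear_combination e - hφσ b d hbd - hφσ a c hac + hφσ b c hbc + hφσ a d had
  exact_mod_cast (mul_eq_zero.1 this).resolve_right hpi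

end RainbowPlanar

/-! ### Weak planarity and contraction -/

namespace RainbowPlanar

open SimpleGraph Complex

/-- A graph is weakly planar if its edges can be drawn as curves in the plane such that
vertex-disjoint edges do not meet. Unlike planarity, this is evidently inherited by
contractions. -/
def WeaklyPlanar {V : Type*} (G : SimpleGraph V) : Prop :=
  ∃ (p : V → ℂ) (S : V → V → Set ℂ), (∀ u v, G.Adj u v → JoinedIn (S u v) (p u) (p v)) ∧
    ∀ a b c d, G.Adj a b → G.Adj c d → a ≠ c → a ≠ d → b ≠ c → b ≠ d →
      Disjoint (S a b) (S c d)

/-- The graph obtained by contracting the edge `uv` to the vertex `u`. -/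
def contract {V : Type*} (G : SimpleGraph V) (u v : V) : SimpleGraph V where
  Adj x y := x ≠ y ∧ x ≠ v ∧ y ≠ v ∧ (G.Adj x y ∨ (x = u ∧ G.Adj v y) ∨ (y = u ∧ G.Adj v x))
  symm := ⟨fun x y h => ⟨h.1.symm, h.2.2.1, h.2.1, by
    rcases h.2.2.2 with h | h | h
    · exact Or.inl h.symm
    · exact Or.inr (Or.inr h)
    · exact Or.inr (Or.inl h)⟩⟩
  loopless := ⟨fun x h => h.1 rfl⟩

variable {V : Type*} {G H : SimpleGraph V}

theorem WeaklyPlanar.mono (h : H ≤ G) (hG : WeaklyPlanar G) : WeaklyPlanar H := by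
  obtain ⟨p, S, hS, hd⟩ := hG
  exact ⟨p, S, fun u v huv => hS u v (h huv), fun a b c d hab hcd => hd a b c d (h hab) (h hcd)⟩

/-- Route each new edge along `uv` and then along an old edge at `v`. New edges may overlap, but
they all end at `u`, so no two of them are vertex-disjoint. -/
theorem WeaklyPlanar.contract (hG : WeaklyPlanar G) {u v : V} (huv : G.Adj u v) :
    WeaklyPlanar (contract G u v) := by
  classical
  obtain ⟨p, S, hS, hd⟩ := hG
  refine ⟨p, fun x y => if G.Adj x y then S x y else
    if x = u then S u v ∪ S v y else S x v ∪ S v u, ?_, ?_⟩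
  · rintro x y ⟨hxy, hxv, hyv, h⟩
    by_cases hadj : G.Adj x y
    · simpa [hadj] using hS x y hadj
    · rcases h with h | ⟨rfl, h⟩ | ⟨rfl, h⟩
      · exact absurd h hadj
      · simpa [hadj] using ((hS x v huv).mono Set.subset_union_left).trans
          ((hS v y h).mono Set.subset_union_right)
      · simpa [hadj, hxy] using ((hS x v h.symm).mono Set.subset_union_left).trans
          ((hS v y huv.symm).mono Set.subset_union_right)
  · have key : ∀ a b c d, G.Adj a b → a ≠ v → b ≠ v → (RainbowPlanar.contract G u v).Adj c d →
        ¬ G.Adj c d → a ≠ c → a ≠ d → b ≠ c → b ≠ d →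
        Disjoint (S a b) (if c = u then S u v ∪ S v d else S c v ∪ S v u) := by
      rintro a b c d hab hav hbv ⟨hcd, hcv, hdv, h⟩ hncd hac had hbc hbd
      rcases h with h | ⟨rfl, h⟩ | ⟨rfl, h⟩
      · exact absurd h hncd
      · rw [if_pos rfl, Set.disjoint_union_right]
        exact ⟨hd _ _ _ _ hab huv hac hav hbc hbv, hd _ _ _ _ hab h hav had hbv hbd⟩
      · rw [if_neg hcd, Set.disjoint_union_right]
        exact ⟨hd _ _ _ _ hab h.symm hac hav hbc hbv, hd _ _ _ _ hab huv.symm hav had hbv hbd⟩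
    intro a b c d hab hcd hac had hbc hbd
    by_cases h1 : G.Adj a b <;> by_cases h2 : G.Adj c d
    · simpa [h1, h2] using hd a b c d h1 h2 hac had hbc hbd
    · simpa only [h1, h2, if_true, if_false] using
        key a b c d h1 hab.2.1 hab.2.2.1 hcd h2 hac had hbc hbd
    · simpa only [h1, h2, if_true, if_false] using
        (key c d a b h2 hcd.2.1 hcd.2.2.1 hab h1 hac.symm hbc.symm had.symm hbd.symm).symm
    · obtain ⟨-, -, -, h3⟩ := hab
      obtain ⟨-, -, -, h4⟩ := hcd
      grind

/-- Weakly planar graphs do not contain the complete graph on five vertices. -/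
theorem WeaklyPlanar.cliqueFree_five (hG : WeaklyPlanar G) : G.CliqueFree 5 := by
  by_contra hc
  obtain ⟨f⟩ := (not_cliqueFree_iff_top_isContained 5).1 hc
  obtain ⟨p, S, hS, hd⟩ := hG
  have hf : ∀ a b, a ≠ b → G.Adj (f a) (f b) := fun a b h => f.toHom.map_adj (by simpa using h)
  have hne : ∀ a b, a ≠ b → f a ≠ f b := fun a b h => f.injective.ne h
  have hγ : ∀ a b : Fin 5, ∃ γ : Path (p (f a)) (p (f b)), a ≠ b → ∀ t, γ t ∈ S (f a) (f b) := by
    intro a b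
    by_cases h : a = b
    · exact ⟨PathConnectedSpace.somePath _ _, fun h' => absurd h h'⟩
    · exact ⟨(hS _ _ (hf a b h)).somePath, fun _ => (hS _ _ (hf a b h)).somePath_mem⟩
  choose γ hγ using hγ
  refine no_weak_drawing_K5 (fun a => p (f a)) γ ?_
  intro a b c d hab hcd hac had hbc hbd s t hst
  exact Set.disjoint_left.1 (hd _ _ _ _ (hf a b hab.ne) (hf c d hcd.ne) (hne _ _ hac) (hne _ _ had)
    (hne _ _ hbc) (hne _ _ hbd)) (hγ a b hab.ne s) (hst ▸ hγ c d hcd.ne t)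

theorem IsPlanar.weaklyPlanar (hG : IsPlanar G) : WeaklyPlanar G := by
  classical
  obtain ⟨D⟩ := hG
  have hends : ∀ (e : G.edgeSet) (t : unitInterval), t ∉ Set.Ioo 0 1 →
      ∃ v ∈ (e : Sym2 V), D.arc e t = D.point v := by
    intro e t ht
    have hmem : D.arc e t ∈ s(D.arc e 0, D.arc e 1) := by
      have : t = 0 ∨ t = 1 := by
        by_contra! h
        exact ht ⟨unitInterval.pos_iff_ne_zero.2 h.1, unitInterval.lt_one_iff_ne_one.2 h.2⟩
      rcases this with rfl | rfl <;> simp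
    rw [D.arc_ends e, Sym2.mem_map] at hmem
    obtain ⟨v, hv, h⟩ := hmem
    exact ⟨v, hv, h.symm⟩
  refine ⟨fun v => equivRealProdCLM.symm (D.point v), fun u v =>
    {z | ∃ (h : G.Adj u v) (t : unitInterval), z = equivRealProdCLM.symm (D.arc ⟨s(u, v), h⟩ t)},
    ?_, ?_⟩
  · intro u v h
    have hends := D.arc_ends ⟨s(u, v), h⟩
    have hj : JoinedIn {z | ∃ (h : G.Adj u v) (t : unitInterval),
        z = equivRealProdCLM.symm (D.arc ⟨s(u, v), h⟩ t)}
        (equivRealProdCLM.symm (D.arc ⟨s(u, v), h⟩ 0))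
        (equivRealProdCLM.symm (D.arc ⟨s(u, v), h⟩ 1)) :=
      ⟨⟨⟨fun t => equivRealProdCLM.symm (D.arc ⟨s(u, v), h⟩ t),
        equivRealProdCLM.symm.continuous.comp (D.arc_continuous _)⟩, rfl, rfl⟩,
        fun t => ⟨h, t, rfl⟩⟩
    rw [Sym2.map_mk, Sym2.eq_iff] at hends
    rcases hends with ⟨h0, h1⟩ | ⟨h0, h1⟩
    · rwa [h0, h1] at hj
    · rw [h0, h1] at hj
      exact hj.symm
  · intro a b c d _ _ hac had hbc hbd
    rw [Set.disjoint_left]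
    rintro _ ⟨hab, s, rfl⟩ ⟨hcd, t, hst⟩
    replace hst := equivRealProdCLM.symm.injective hst
    have hne : (⟨s(a, b), hab⟩ : G.edgeSet) ≠ ⟨s(c, d), hcd⟩ := by
      intro h
      have := congrArg Subtype.val h
      simp only [Sym2.eq_iff] at this
      tauto
    by_cases hs : s ∈ Set.Ioo 0 1
    · exact D.arc_ne_arc _ _ hne s hs t hst
    by_cases ht : t ∈ Set.Ioo 0 1
    · exact D.arc_ne_arc _ _ hne.symm t ht s hst.symm
    obtain ⟨v, hv, hv'⟩ := hends _ s hs
    obtain ⟨w, hw, hw'⟩ := hends _ t ht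
    rw [hv', hw'] at hst
    have := D.point_injective hst
    subst this
    simp only [Sym2.mem_iff] at hv hw
    grind

end RainbowPlanar

/-! ### The edge bound 3m - 6 -/

namespace RainbowPlanar

open SimpleGraph Finset

variable {V : Type*} {G H : SimpleGraph V}

theorem exists_le_ncard_edgeSet_eq [Finite V] (G : SimpleGraph V) {k : ℕ}
    (hk : k ≤ G.edgeSet.ncard) : ∃ H ≤ G, H.edgeSet.ncard = k := by
  obtain ⟨T, hT, hcard⟩ := Set.exists_subset_card_eq hk
  refine ⟨fromEdgeSet T, ?_, ?_⟩
  · intro x y h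
    exact hT ((fromEdgeSet_adj T).1 h).1
  · rw [edgeSet_fromEdgeSet, ← hcard]
    congr 1
    rw [sdiff_eq_left, Set.disjoint_left]
    intro e he hd
    exact G.not_isDiag_of_mem_edgeSet (hT he) hd

theorem ncard_edgeSet_eq_card_edgeFinset [Fintype V] [DecidableRel G.Adj] :
    G.edgeSet.ncard = #G.edgeFinset :=
  Set.ncard_eq_toFinset_card' _

theorem sum_degrees_of_support_subset [Fintype V] [DecidableRel G.Adj] {s : Finset V}
    (hs : G.support ⊆ s) :
    ∑ v ∈ s, G.degree v = 2 * G.edgeSet.ncard := by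
  rw [ncard_edgeSet_eq_card_edgeFinset, ← sum_degrees_eq_twice_card_edges]
  refine sum_subset (subset_univ s) fun v _ hv => ?_
  rw [degree_eq_zero_iff_notMem_support]
  exact fun h => hv (hs h)

section Fintype

variable [Fintype V] [DecidableEq V] [DecidableRel G.Adj]

theorem ncard_edgeSet_deleteIncidenceSet_add_degree (v : V) :
    (G.deleteIncidenceSet v).edgeSet.ncard + G.degree v = G.edgeSet.ncard := by
  rw [ncard_edgeSet_eq_card_edgeFinset, ncard_edgeSet_eq_card_edgeFinset,
    card_edgeFinset_deleteIncidenceSet]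
  have := card_le_card (G.incidenceFinset_subset v)
  rw [card_incidenceFinset_eq_degree] at this
  omega

/-- Contracting an edge loses this edge and one edge for each common neighbour of its ends. -/
theorem ncard_edgeSet_le_contract {u v : V} (huv : G.Adj u v) :
    G.edgeSet.ncard ≤ (contract G u v).edgeSet.ncard + 1 +
      #(G.neighborFinset u ∩ G.neighborFinset v) := by
  set T := G.neighborFinset v \ insert u (G.neighborFinset u) with hT
  have hsub : (G.deleteIncidenceSet v).edgeSet ∪ (Set.image (fun y => s(u, y)) T) ⊆
      (contract G u v).edgeSet := by
    rintro e (he | ⟨y, hy, rfl⟩)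
    · induction e with | _ x y =>
      rw [mem_edgeSet, deleteIncidenceSet_adj] at he
      exact ⟨he.1.ne, he.2.1, he.2.2, Or.inl he.1⟩
    · simp only [hT, coe_sdiff, Set.mem_sdiff, mem_coe, mem_neighborFinset, mem_insert, not_or] at hy
      exact ⟨Ne.symm hy.2.1, huv.ne, hy.1.ne', Or.inr (Or.inl ⟨rfl, hy.1⟩)⟩
  have hdisj : Disjoint (G.deleteIncidenceSet v).edgeSet (Set.image (fun y => s(u, y)) T) := by
    rw [Set.disjoint_left]
    rintro _ he ⟨y, hy, rfl⟩
    rw [mem_edgeSet, deleteIncidenceSet_adj] at he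
    simp only [hT, coe_sdiff, Set.mem_sdiff, mem_coe, mem_neighborFinset, mem_insert, not_or] at hy
    exact hy.2.2 he.1
  have hinj : Function.Injective (fun y => s(u, y)) := fun y z h => Sym2.congr_right.1 h
  have h1 := Set.ncard_le_ncard hsub (Set.toFinite _)
  rw [Set.ncard_union_eq hdisj (Set.toFinite _) (Set.toFinite _), Set.ncard_image_of_injective _ hinj,
    Set.ncard_coe_finset] at h1
  have h2 := ncard_edgeSet_deleteIncidenceSet_add_degree (G := G) v
  have h3 : G.degree v ≤ #T + (1 + #(G.neighborFinset u ∩ G.neighborFinset v)) := by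
    rw [← card_neighborFinset_eq_degree, ← card_sdiff_add_card_inter _ (insert u (G.neighborFinset u))]
    gcongr
    refine (card_le_card ?_).trans ((card_insert_le u _).trans_eq (add_comm _ _))
    intro x
    simp only [mem_inter, mem_insert]
    tauto
  omega

theorem isNClique_insert_neighborFinset {v : V} {n : ℕ} (hn : G.degree v = n)
    (h : ∀ a ∈ G.neighborFinset v, ∀ b ∈ G.neighborFinset v, a ≠ b → G.Adj a b) :
    G.IsNClique (n + 1) (insert v (G.neighborFinset v)) :=
  IsNClique.insert ⟨fun a ha b hb => h a ha b hb, hn⟩ fun b hb => by simpa using hb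

/-- If the neighbourhood of a vertex of degree four or five has minimum degree three, then the
graph contains a complete graph on five vertices, possibly after contracting an edge. -/
theorem not_weaklyPlanar_of_common_neighbors {v : V} (hdeg : G.degree v = 4 ∨ G.degree v = 5)
    (h : ∀ u, G.Adj v u → 3 ≤ #(G.neighborFinset u ∩ G.neighborFinset v)) :
    ¬ WeaklyPlanar G := by
  intro hG
  set N := G.neighborFinset v with hN
  -- The 4 counts `u` and three of its neighbours in `N`. So each vertex misses at most one other:
  -- the non-edges within `N` form a matching, empty if the degree is 4.
  have hmiss : ∀ u ∈ N, #{x ∈ N | x ≠ u ∧ ¬ G.Adj u x} + 4 ≤ G.degree v := by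
    intro u hu
    have h3 := h u (by simpa [hN] using hu)
    have e : #({x ∈ N | x ≠ u ∧ ¬ G.Adj u x} ∪ (G.neighborFinset u ∩ N) ∪ {u}) ≤ #N := by
      apply card_le_card
      intro x
      simp only [mem_union, mem_filter, mem_inter, mem_singleton]
      grind
    rw [card_union_of_disjoint, card_union_of_disjoint] at e
    · rw [show #N = G.degree v from card_neighborFinset_eq_degree G v] at e
      simp only [card_singleton] at e
      omega
    · rw [Finset.disjoint_left]
      intro x
      simp only [mem_filter, mem_inter, mem_neighborFinset]
      tauto
    · rw [Finset.disjoint_left]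
      intro x
      simp only [mem_union, mem_filter, mem_inter, mem_neighborFinset, mem_singleton]
      rintro (hx | hx) rfl
      · exact hx.2.1 rfl
      · exact G.loopless.irrefl _ hx.1
  by_cases hclique : ∀ a ∈ N, ∀ b ∈ N, a ≠ b → G.Adj a b
  · have := isNClique_insert_neighborFinset rfl hclique
    have h4 : 5 ≤ G.degree v + 1 := by omega
    exact (hG.cliqueFree_five.mono h4) _ this
  push Not at hclique
  obtain ⟨a, ha, b, hb, hab, hnab⟩ := hclique
  have huniq : ∀ u ∈ N, ∀ x ∈ N, ∀ y ∈ N, x ≠ u → y ≠ u → ¬ G.Adj u x → x ≠ y → G.Adj u y := by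
    intro u hu x hx y hy hxu hyu hux hxy
    by_contra huy
    have h1 : #{x ∈ N | x ≠ u ∧ ¬ G.Adj u x} ≤ 1 := by
      have := hmiss u hu
      omega
    exact hxy (card_le_one.1 h1 x (mem_filter.2 ⟨hx, hxu, hux⟩) y (mem_filter.2 ⟨hy, hyu, huy⟩))
  have h5 : #N = 5 := by
    have h1 : 0 < #{x ∈ N | x ≠ a ∧ ¬ G.Adj a x} :=
      card_pos.2 ⟨b, by simp [hb, hab.symm, hnab]⟩
    have := hmiss a ha
    rw [hN, card_neighborFinset_eq_degree]
    omega
  have hrest : #((N.erase a).erase b) = 3 := by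
    rw [card_erase_of_mem (by simp [hb, hab.symm]), card_erase_of_mem ha, h5]
  obtain ⟨c, d, e, hc, hd, he, hcd, hce, hde, hadj⟩ : ∃ c d e, c ∈ (N.erase a).erase b ∧
      d ∈ (N.erase a).erase b ∧ e ∈ (N.erase a).erase b ∧ c ≠ d ∧ c ≠ e ∧ d ≠ e ∧
      G.Adj d e := by
    obtain ⟨x, y, z, hxy, hxz, hyz, hs⟩ := card_eq_three.1 hrest
    have hx : x ∈ (N.erase a).erase b := by simp [hs]
    have hy : y ∈ (N.erase a).erase b := by simp [hs]
    have hz : z ∈ (N.erase a).erase b := by simp [hs]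
    by_cases h' : G.Adj y z
    · exact ⟨x, y, z, hx, hy, hz, hxy, hxz, hyz, h'⟩
    · refine ⟨z, y, x, hz, hy, hx, hyz.symm, hxz.symm, hxy.symm, ?_⟩
      simp only [mem_erase] at hx hy hz
      exact huniq y hy.2.2 z hz.2.2 x hx.2.2 hyz.symm hxy h' hxz.symm
  simp only [mem_erase] at hc hd he
  have ha' : ∀ x ∈ N, x ≠ a → x ≠ b → G.Adj a x := fun x hx hxa hxb =>
    huniq a ha b hb x hx hab.symm hxa hnab hxb.symm
  have hb' : ∀ x ∈ N, x ≠ a → x ≠ b → G.Adj b x := fun x hx hxa hxb =>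
    huniq b hb a ha x hx hab hxb (fun h => hnab h.symm) hxa.symm
  have hv' : ∀ x ∈ N, G.Adj v x := fun x hx => by simpa [hN] using hx
  have hac := ha' c hc.2.2 hc.2.1 hc.1
  have had := ha' d hd.2.2 hd.2.1 hd.1
  have hae := ha' e he.2.2 he.2.1 he.1
  have hbc := hb' c hc.2.2 hc.2.1 hc.1
  have hbd := hb' d hd.2.2 hd.2.1 hd.1
  have hbe := hb' e he.2.2 he.2.1 he.1
  have hva := hv' a ha
  have hvb := hv' b hb
  have hvc := hv' c hc.2.2
  have hvd := hv' d hd.2.2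
  have hve := hv' e he.2.2
  -- Contracting `ac` supplies the missing edge `ab`, so `v, a, b, d, e` become a K₅.
  have hlift : ∀ x y, G.Adj x y → x ≠ c → y ≠ c → (contract G a c).Adj x y :=
    fun x y hxy hxc hyc => ⟨hxy.ne, hxc, hyc, Or.inl hxy⟩
  have hab' : (contract G a c).Adj a b :=
    ⟨hab, hac.ne, hbc.ne, Or.inr (Or.inl ⟨rfl, hbc.symm⟩)⟩
  have h3 : (contract G a c).IsNClique 3 {b, d, e} := is3Clique_triple_iff.2
    ⟨hlift _ _ hbd hbc.ne hcd.symm, hlift _ _ hbe hbc.ne hce.symm,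
      hlift _ _ hadj hcd.symm hce.symm⟩
  have h4 := h3.insert (a := a) (by
    simp only [mem_insert, mem_singleton, forall_eq_or_imp, forall_eq]
    exact ⟨hab', hlift _ _ had hac.ne hcd.symm, hlift _ _ hae hac.ne hce.symm⟩)
  have h5 := h4.insert (a := v) (by
    simp only [mem_insert, mem_singleton, forall_eq_or_imp, forall_eq]
    exact ⟨hlift _ _ hva hvc.ne hac.ne, hlift _ _ hvb hvc.ne hbc.ne,
      hlift _ _ hvd hvc.ne hcd.symm, hlift _ _ hve hvc.ne hce.symm⟩)
  exact (hG.contract hac).cliqueFree_five _ h5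

end Fintype

/-- A weakly planar graph whose edges live on `m ≥ 3` vertices has at most `3 m - 6` edges. -/
theorem ncard_edgeSet_add_six_le_of_support_subset [Fintype V] {m : ℕ} (hm : 3 ≤ m) :
    ∀ (s : Finset V) (G : SimpleGraph V), #s = m → G.support ⊆ s → WeaklyPlanar G →
      G.edgeSet.ncard + 6 ≤ 3 * m := by
  classical
  induction m, hm using Nat.le_induction with
  | base =>
    intro s G hs hsupp _
    have h1 := sum_degrees_of_support_subset hsupp
    have h2 : ∑ v ∈ s, G.degree v ≤ ∑ v ∈ s, 2 := by
      refine sum_le_sum fun v hv => ?_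
      have h3 : #(s.erase v) = 2 := by rw [card_erase_of_mem hv, hs]
      rw [← h3, ← card_neighborFinset_eq_degree]
      refine card_le_card fun x hx => ?_
      rw [mem_neighborFinset] at hx
      exact mem_erase.2 ⟨hx.ne', hsupp ⟨v, hx.symm⟩⟩
    rw [sum_const, hs] at h2
    simp at h2
    omega
  | succ m hm ih =>
    intro s G hs hsupp hG
    by_contra! hlt
    -- Exactly one edge above the bound: few enough for average degree below 6, enough to contradict
    -- the bounds for `m` vertices.
    obtain ⟨H, hHG, hH⟩ := exists_le_ncard_edgeSet_eq G (k := 3 * (m + 1) - 5) (by omega)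
    replace hG := hG.mono hHG
    replace hsupp : H.support ⊆ s := (support_mono hHG).trans hsupp
    obtain ⟨v, hv, hdeg⟩ : ∃ v ∈ s, H.degree v < 6 := by
      apply exists_lt_of_sum_lt
      rw [sum_degrees_of_support_subset hsupp, sum_const, hs, hH]
      simp only [smul_eq_mul]
      omega
    have hsv : #(s.erase v) = m := by rw [card_erase_of_mem hv, hs]; rfl
    have hdel := ih (s.erase v) (H.deleteIncidenceSet v) hsv (by
      rw [coe_erase]
      exact (support_deleteIncidenceSet_subset H v).trans (Set.sdiff_subset_sdiff_left hsupp))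
      (hG.mono (deleteIncidenceSet_le H v))
    have hdel' := ncard_edgeSet_deleteIncidenceSet_add_degree (G := H) v
    refine not_weaklyPlanar_of_common_neighbors (v := v) (by omega) (fun u hu => ?_) hG
    have hcon := ih (s.erase v) (contract H u v) hsv (by
      rintro x ⟨y, hx⟩
      rw [coe_erase]
      refine ⟨?_, hx.2.1⟩
      rcases hx.2.2.2 with h | ⟨rfl, h⟩ | ⟨rfl, h⟩
      · exact hsupp ⟨y, h⟩
      · exact hsupp ⟨v, hu.symm⟩
      · exact hsupp ⟨v, h.symm⟩) (hG.contract hu.symm)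
    have := ncard_edgeSet_le_contract hu.symm
    omega

theorem IsPlanar.ncard_edgeSet_add_six_le [Fintype V] (hG : IsPlanar G)
    (hV : 3 ≤ Fintype.card V) : G.edgeSet.ncard + 6 ≤ 3 * Fintype.card V :=
  ncard_edgeSet_add_six_le_of_support_subset hV univ G card_univ (by simp) hG.weaklyPlanar

end RainbowPlanar

/-! ### The extremal graph and its edges -/

namespace RainbowPlanar

open SimpleGraph Finset

/-- The join of an edge `01` with the path `2, 3, …, n - 1`. -/
def doubleFan (n : ℕ) : SimpleGraph (Fin n) where
  Adj x y := x ≠ y ∧ (x.val < 2 ∨ y.val < 2 ∨ x.val + 1 = y.val ∨ y.val + 1 = x.val)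
  symm := ⟨fun x y h => ⟨h.1.symm, by tauto⟩⟩
  loopless := ⟨fun x h => h.1 rfl⟩

variable {n : ℕ}

theorem doubleFan_adj {x y : Fin n} : (doubleFan n).Adj x y ↔
    x ≠ y ∧ (x.val < 2 ∨ y.val < 2 ∨ x.val + 1 = y.val ∨ y.val + 1 = x.val) := Iff.rfl

theorem exists_lt_of_mem_edgeSet_doubleFan {e : Sym2 (Fin n)} (he : e ∈ (doubleFan n).edgeSet) :
    ∃ a b, e = s(a, b) ∧ e.inf = a ∧ e.sup = b ∧ a < b ∧ (a.val < 2 ∨ b.val = a.val + 1) := by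
  induction e with | _ x y =>
  obtain ⟨hxy, h⟩ := doubleFan_adj.1 ((mem_edgeSet _).1 he)
  rcases lt_or_gt_of_ne hxy with hlt | hlt
  · refine ⟨x, y, rfl, by simp [hlt.le], by simp [hlt.le], hlt, ?_⟩
    have : x.val < y.val := hlt
    omega
  · refine ⟨y, x, Sym2.eq_swap, by simp [hlt.le], by simp [hlt.le], hlt, ?_⟩
    have : y.val < x.val := hlt
    omega

theorem le_ncard_edgeSet_doubleFan (hn : 3 ≤ n) : 3 * n - 6 ≤ (doubleFan n).edgeSet.ncard := by
  let f : Fin (n - 1) ⊕ Fin (n - 2) ⊕ Fin (n - 3) → (doubleFan n).edgeSet := Sum.elim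
    (fun i => ⟨s(⟨0, by omega⟩, ⟨i + 1, by omega⟩), by simp [doubleFan_adj]⟩) <| Sum.elim
    (fun i => ⟨s(⟨1, by omega⟩, ⟨i + 2, by omega⟩), by simp [doubleFan_adj]⟩)
    (fun i => ⟨s(⟨i + 2, by omega⟩, ⟨i + 3, by omega⟩), by simp [doubleFan_adj]⟩)
  have hf : Function.Injective f := by
    rintro (i | i | i) (j | j | j) h <;>
      have h' := congrArg Subtype.val h <;>
      simp only [f, Sum.elim_inl, Sum.elim_inr, Sym2.eq_iff, Fin.mk.injEq] at h' <;>
      first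
      | (exfalso; omega)
      | (have : i = j := by
          apply Fin.ext
          omega
         rw [this])
  have := Nat.card_le_card_of_injective f hf
  simp only [Nat.card_sum, Nat.card_fin, Nat.card_coe_set_eq] at this
  omega

/-! ### Straight-line drawing of the double fan -/

section Drawing

/-- The first coordinate of a vertex of the double fan. -/
def fanX (j : ℕ) : ℝ := if j = 0 then -1 else if j = 1 then 1 else 0

/-- The second coordinate of a vertex of the double fan. -/
def fanY (j : ℕ) : ℝ := if j < 2 then 0 else j

theorem fan_injective {a b : ℕ} (hX : fanX a = fanX b) (hY : fanY a = fanY b) : a = b := by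
  have cases_of (j : ℕ) : j = 0 ∨ j = 1 ∨ 2 ≤ j := by omega
  have hx (j : ℕ) (h : 2 ≤ j) : fanX j = 0 := by
    simp [fanX, show j ≠ 0 by omega, show j ≠ 1 by omega]
  rcases cases_of a with rfl | rfl | ha <;> rcases cases_of b with rfl | rfl | hb
  · rfl
  · norm_num [fanX] at hX
  · rw [hx b hb] at hX; norm_num [fanX] at hX
  · norm_num [fanX] at hX
  · rfl
  · rw [hx b hb] at hX; norm_num [fanX] at hX
  · rw [hx a ha] at hX; norm_num [fanX] at hX
  · rw [hx a ha] at hX; norm_num [fanX] at hX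
  · simpa [fanY, ha.not_gt, hb.not_gt] using hY

/-- A point on an edge of the double fan has one of four forms. -/
theorem fan_edge_cases {a b : ℕ} (hab : a < b) (h : a < 2 ∨ b = a + 1) (s : ℝ) :
    (a = 0 ∧ b = 1 ∧ (1 - s) * fanX a + s * fanX b = 2 * s - 1 ∧
      (1 - s) * fanY a + s * fanY b = 0) ∨
    (a = 0 ∧ 2 ≤ b ∧ (1 - s) * fanX a + s * fanX b = s - 1 ∧
      (1 - s) * fanY a + s * fanY b = s * b) ∨
    (a = 1 ∧ 2 ≤ b ∧ (1 - s) * fanX a + s * fanX b = 1 - s ∧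
      (1 - s) * fanY a + s * fanY b = s * b) ∨
    (2 ≤ a ∧ b = a + 1 ∧ (1 - s) * fanX a + s * fanX b = 0 ∧
      (1 - s) * fanY a + s * fanY b = a + s) := by
  have hx (j : ℕ) (h : 2 ≤ j) : fanX j = 0 := by
    simp [fanX, show j ≠ 0 by omega, show j ≠ 1 by omega]
  have hy (j : ℕ) (h : 2 ≤ j) : fanY j = j := by simp [fanY, h.not_gt]
  have hx0 : fanX 0 = -1 := by simp [fanX]
  have hx1 : fanX 1 = 1 := by simp [fanX]
  have hy0 : fanY 0 = 0 := by simp [fanY]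
  have hy1 : fanY 1 = 0 := by simp [fanY]
  obtain ⟨rfl, rfl⟩ | ⟨rfl, hb⟩ | ⟨rfl, hb⟩ | ⟨ha, rfl⟩ : (a = 0 ∧ b = 1) ∨ (a = 0 ∧ 2 ≤ b) ∨
      (a = 1 ∧ 2 ≤ b) ∨ (2 ≤ a ∧ b = a + 1) := by omega
  · left
    rw [hx0, hx1, hy0, hy1]
    exact ⟨rfl, rfl, by ring, by ring⟩
  · right; left
    rw [hx0, hx b hb, hy0, hy b hb]
    exact ⟨rfl, hb, by ring, by ring⟩
  · right; right; left
    rw [hx1, hx b hb, hy1, hy b hb]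
    exact ⟨rfl, hb, by ring, by ring⟩
  · right; right; right
    rw [hx a ha, hx (a + 1) (by omega), hy a ha, hy (a + 1) (by omega)]
    exact ⟨ha, rfl, by ring, by push_cast; ring⟩

theorem not_nat_add_eq {a d : ℕ} {s : ℝ} (h0 : 0 < s) (h1 : s < 1) : (a : ℝ) + s ≠ d := by
  intro h
  have h2 : (a : ℝ) < d := by linarith
  have h3 : (d : ℝ) < a + 1 := by linarith
  norm_cast at h2 h3
  omega

/-- Two edges of the double fan meet only in common ends. -/
theorem fan_no_crossing {a b c d : ℕ} (hab : a < b) (h : a < 2 ∨ b = a + 1) (hcd : c < d)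
    (h' : c < 2 ∨ d = c + 1) {s t : ℝ} (hs0 : 0 < s) (hs1 : s < 1) (ht0 : 0 ≤ t) (ht1 : t ≤ 1)
    (hX : (1 - s) * fanX a + s * fanX b = (1 - t) * fanX c + t * fanX d)
    (hY : (1 - s) * fanY a + s * fanY b = (1 - t) * fanY c + t * fanY d) : a = c ∧ b = d := by
  have hzero (r : ℝ) (j : ℕ) (hj : 2 ≤ j) (hr : r * j = 0) : r = 0 := by
    rcases mul_eq_zero.1 hr with h | h
    · exact h
    · norm_cast at h; omega
  rcases fan_edge_cases hab h s with ⟨rfl, rfl, ex, ey⟩ | ⟨rfl, hb, ex, ey⟩ | ⟨rfl, hb, ex, ey⟩ |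
    ⟨ha, rfl, ex, ey⟩ <;>
  rcases fan_edge_cases hcd h' t with ⟨rfl, rfl, fx, fy⟩ | ⟨rfl, hd, fx, fy⟩ | ⟨rfl, hd, fx, fy⟩ |
    ⟨hc, rfl, fx, fy⟩ <;>
  rw [ex, fx] at hX <;> rw [ey, fy] at hY
  · exact ⟨rfl, rfl⟩
  · have := hzero t d hd hY.symm
    linarith
  · have := hzero t d hd hY.symm
    linarith
  · have : (2 : ℝ) ≤ c := by exact_mod_cast hc
    linarith
  · have := hzero s b hb hY
    linarith
  · have hst : s = t := by linarith
    rw [hst] at hY hs0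
    exact ⟨rfl, by exact_mod_cast mul_left_cancel₀ hs0.ne' hY⟩
  · linarith
  · linarith
  · have := hzero s b hb hY
    linarith
  · linarith
  · have hst : s = t := by linarith
    rw [hst] at hY hs0
    exact ⟨rfl, by exact_mod_cast mul_left_cancel₀ hs0.ne' hY⟩
  · linarith
  · have : (2 : ℝ) ≤ a := by exact_mod_cast ha
    linarith
  · have : t = 1 := by linarith
    rw [this, one_mul] at hY
    exact absurd hY (not_nat_add_eq hs0 hs1)
  · have : t = 1 := by linarith
    rw [this, one_mul] at hY
    exact absurd hY (not_nat_add_eq hs0 hs1)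
  · have h1 : (a : ℝ) < c + 1 := by linarith
    have h2 : (c : ℝ) < a + 1 := by linarith
    norm_cast at h1 h2
    omega

/-- Each vertex is an end of an edge other than `ab` in the infinite fan, so `fan_no_crossing`
applies; the index `a + b + 2` serves only to exceed `b`. -/
theorem fan_no_vertex {a b v : ℕ} (hab : a < b) (h : a < 2 ∨ b = a + 1) {s : ℝ} (hs0 : 0 < s)
    (hs1 : s < 1) (hX : (1 - s) * fanX a + s * fanX b = fanX v)
    (hY : (1 - s) * fanY a + s * fanY b = fanY v) : False := by
  by_cases hv : v = 0
  · have := fan_no_crossing hab h (c := 0) (d := a + b + 2) (by omega) (by omega) hs0 hs1 le_rfl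
      zero_le_one (by rw [hX, hv]; ring) (by rw [hY, hv]; ring)
    omega
  · have h1 := fan_no_crossing hab h (c := 0) (d := v) (by omega) (by omega) hs0 hs1 zero_le_one
      le_rfl (by rw [hX]; ring) (by rw [hY]; ring)
    by_cases hv1 : v = 1
    · have h2 := fan_no_crossing hab h (c := 1) (d := 2) (by omega) (by omega) hs0 hs1 le_rfl
        zero_le_one (by rw [hX, hv1]; ring) (by rw [hY, hv1]; ring)
      omega
    · have h2 := fan_no_crossing hab h (c := 1) (d := v) (by omega) (by omega) hs0 hs1 zero_le_one
        le_rfl (by rw [hX]; ring) (by rw [hY]; ring)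
      omega

theorem isPlanar_doubleFan (n : ℕ) : IsPlanar (doubleFan n) := by
  refine ⟨{
    point := fun v => (fanX v, fanY v)
    arc := fun e t =>
      ((1 - (t : ℝ)) * fanX e.1.inf + t * fanX e.1.sup,
        (1 - (t : ℝ)) * fanY e.1.inf + t * fanY e.1.sup)
    point_injective := ?_
    arc_continuous := fun e => by fun_prop
    arc_injective := ?_
    arc_ends := ?_
    arc_ne_point := ?_
    arc_ne_arc := ?_ }⟩
  · intro u v h
    simp only [Prod.mk.injEq] at h
    exact Fin.ext (fan_injective h.1 h.2)
  · rintro ⟨e, he⟩ s t hst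
    obtain ⟨a, b, -, hinf, hsup, hab, -⟩ := exists_lt_of_mem_edgeSet_doubleFan he
    simp only [hinf, hsup, Prod.mk.injEq] at hst
    by_contra hne
    have hne' : (s : ℝ) - t ≠ 0 := sub_ne_zero.2 fun h => hne (Subtype.ext h)
    refine hab.ne (Fin.ext (fan_injective ?_ ?_)) <;> apply mul_left_cancel₀ hne'
    · linear_combination -hst.1
    · linear_combination -hst.2
  · rintro ⟨e, he⟩
    obtain ⟨a, b, rfl, hinf, hsup, -⟩ := exists_lt_of_mem_edgeSet_doubleFan he
    simp only [hinf, hsup]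
    simp
  · rintro ⟨e, he⟩ t ⟨ht0, ht1⟩ v h
    obtain ⟨a, b, -, hinf, hsup, hab, h'⟩ := exists_lt_of_mem_edgeSet_doubleFan he
    simp only [hinf, hsup, Prod.mk.injEq] at h
    exact fan_no_vertex hab h' (s := t) ht0 ht1 h.1 h.2
  · rintro ⟨e, he⟩ ⟨f, hf⟩ hne s ⟨hs0, hs1⟩ t h
    obtain ⟨a, b, rfl, hinf, hsup, hab, h1⟩ := exists_lt_of_mem_edgeSet_doubleFan he
    obtain ⟨c, d, rfl, hinf', hsup', hcd, h2⟩ := exists_lt_of_mem_edgeSet_doubleFan hf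
    simp only [hinf, hsup, hinf', hsup', Prod.mk.injEq] at h
    obtain ⟨e1, e2⟩ := fan_no_crossing hab h1 hcd h2 (s := s) hs0 hs1 t.2.1 t.2.2 h.1 h.2
    apply hne
    congr 2
    · exact Fin.ext e1
    · exact Fin.ext e2

end Drawing

/-! ### The colouring without rainbow paths -/

/-- The colour of an edge of the double fan: the edges of the path alternate between two colours,
and every other edge has a colour of its own. -/
def fanColor (e : Sym2 (Fin n)) : ℕ :=
  if 2 ≤ e.inf.val then e.inf.val % 2 else 2 + Nat.pair e.inf.val e.sup.val

/-- The proper edge-colouring of the double fan by `fanColor`. -/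
def fanColoring (n : ℕ) : (doubleFan n).lineGraph.Coloring ℕ :=
  Coloring.mk (fun e => fanColor e.1) <| by
    rintro ⟨e, he⟩ ⟨f, hf⟩ hadj hc
    obtain ⟨hne, v, hve, hvf⟩ := lineGraph_adj_iff_exists.1 hadj
    obtain ⟨a, b, rfl, hinf, hsup, hab, h1⟩ := exists_lt_of_mem_edgeSet_doubleFan he
    obtain ⟨c, d, rfl, hinf', hsup', hcd, h2⟩ := exists_lt_of_mem_edgeSet_doubleFan hf
    simp only [fanColor, hinf, hsup, hinf', hsup'] at hc
    simp only [Sym2.mem_iff, Fin.ext_iff] at hve hvf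
    apply hne
    suffices a.val = c.val ∧ b.val = d.val by
      congr 2
      · exact Fin.ext this.1
      · exact Fin.ext this.2
    rw [Fin.lt_def] at hab hcd
    split_ifs at hc with h3 h4 h4
    -- Distinct path edges with a common vertex have consecutive lower ends, hence of different
    -- parity.
    · omega
    · omega
    · omega
    · exact Nat.pair_eq_pair.1 (by omega)

/-- The first 8 vertices suffice: of their 7 edges, at most two meet 0, at most two meet 1, and at
most two have colours below 2. -/
theorem rainbowFree_fanColoring {k : ℕ} (hk : 8 ≤ k) :
    RainbowFree (pathGraph k) (fanColoring n) := by
  intro f hinj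
  let w : Fin 8 → Fin n := fun j => f ⟨j, by omega⟩
  have hw : Function.Injective w := fun i j h => by
    have := f.injective h
    simpa [Fin.ext_iff] using this
  let E : Fin 7 → (pathGraph k).edgeSet := fun i =>
    ⟨s(⟨i.castSucc.val, by omega⟩, ⟨i.succ.val, by omega⟩), by simp [pathGraph_adj]⟩
  have hE : Function.Injective E := by
    intro i j h
    have h' := congrArg Subtype.val h
    simp only [E, Sym2.eq_iff, Fin.mk.injEq, Fin.val_castSucc, Fin.val_succ] at h'
    apply Fin.ext
    omega
  have hcol : ∀ i j, fanColor s(w (Fin.castSucc i), w i.succ) =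
      fanColor s(w (Fin.castSucc j), w j.succ) → i = j := fun i j h => hE (hinj h)
  have hone : ∀ (g : Fin 7 → Fin 8) (m : ℕ), Function.Injective g →
      #{i | (w (g i)).val = m} ≤ 1 := by
    intro g m hg
    refine card_le_one.2 fun i hi j hj => hg (hw (Fin.ext ?_))
    rw [(mem_filter.1 hi).2, (mem_filter.1 hj).2]
  have htwo : #{i : Fin 7 | 2 ≤ (w i.castSucc).val ∧ 2 ≤ (w i.succ).val} ≤ 2 := by
    rw [← card_range 2]
    have hval : ∀ i : Fin 7, 2 ≤ (w i.castSucc).val ∧ 2 ≤ (w i.succ).val →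
        fanColor s(w (Fin.castSucc i), w i.succ) < 2 := by
      intro i hi
      have : 2 ≤ (s(w (Fin.castSucc i), w i.succ).inf).val := by
        rcases le_total (w i.castSucc) (w i.succ) with h | h <;> simp [h, hi]
      rw [fanColor, if_pos this]
      omega
    refine card_le_card_of_injOn (fun i => fanColor s(w (Fin.castSucc i), w i.succ)) ?_ ?_
    · intro i hi
      exact mem_coe.2 (mem_range.2 (hval i (mem_filter.1 hi).2))
    · intro i _ j _ h
      exact hcol i j h
  have hcover : (univ : Finset (Fin 7)) ⊆
      ((univ.filter (fun i : Fin 7 => (w i.castSucc).val = 0) ∪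
        univ.filter (fun i : Fin 7 => (w i.succ).val = 0)) ∪
      (univ.filter (fun i : Fin 7 => (w i.castSucc).val = 1) ∪
        univ.filter (fun i : Fin 7 => (w i.succ).val = 1))) ∪
      univ.filter (fun i : Fin 7 => 2 ≤ (w i.castSucc).val ∧ 2 ≤ (w i.succ).val) := by
    intro i _
    simp only [mem_union, mem_filter, mem_univ, true_and]
    omega
  have hcard := (card_le_card hcover).trans ((card_union_le _ _).trans
    (add_le_add ((card_union_le _ _).trans (add_le_add (card_union_le _ _) (card_union_le _ _))) htwo))
  have h1 := hone Fin.castSucc 0 (Fin.castSucc_injective 7)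
  have h2 := hone Fin.succ 0 (Fin.succ_injective 7)
  have h3 := hone Fin.castSucc 1 (Fin.castSucc_injective 7)
  have h4 := hone Fin.succ 1 (Fin.succ_injective 7)
  rw [card_univ, Fintype.card_fin] at hcard
  omega

end RainbowPlanar

theorem theorem2p1 (n k : ℕ) (hk : 8 ≤ k) (hn : k ≤ n) :
    RainbowPlanar.IsRainbowPlanarTuranNumber n (SimpleGraph.pathGraph k) (3 * n - 6) := by
  have upper : ∀ G : SimpleGraph (Fin n), RainbowPlanar.IsPlanar G →
      G.edgeSet.ncard + 6 ≤ 3 * n := fun G hG => by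
    simpa using hG.ncard_edgeSet_add_six_le (by rw [Fintype.card_fin]; omega)
  constructor
  · refine ⟨RainbowPlanar.doubleFan n, RainbowPlanar.fanColoring n,
      RainbowPlanar.isPlanar_doubleFan n, RainbowPlanar.rainbowFree_fanColoring hk, ?_⟩
    have h1 := upper _ (RainbowPlanar.isPlanar_doubleFan n)
    have h2 := RainbowPlanar.le_ncard_edgeSet_doubleFan (n := n) (by omega)
    omega
  · rintro m ⟨G, c, hG, -, rfl⟩
    have := upper G hG
    omega
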